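/- Let $D\subset\mathbb{C}^n$ be a domain (a non-empty connected open set), let $\phi:D\to\mathbb{R}$ be continuous, and let $p>1$ be a real number. Suppose that $\phi$ satisfies the multiple coarse $L^p$-estimate property on $D$, that is: there are constants $C_m>0$ $(m=1,2,3,\dots)$, depending only on $m$, with $\lim_{m\to\infty}\frac{\log C_m}{m}=0$, such that for every integer $m\ge 1$, every $\bar\partial$-closed smooth $(0,1)$-form $f=\sum_j f_j\,d\bar z_j$ with compact support in $D$, and every smooth strictly plurisubharmonic function $\psi:D\to\mathbb{R}$ (that is, $\psi$ is $C^\infty$ and its complex Hessian $\big(\frac{\partial^2\psi}{\partial z_j\partial\bar z_k}\big)_{j,k}$ is positive definite at every point of $D$), there is a function $u:D\to\mathbb{C}$ of class $C^1$ with $\bar\partial u=f$ on $D$ and $$\int_D|u|^p e^{-m\phi-\psi}\,d\lambda\;\le\; C_m\int_D|f|^p_{i\partial\bar\partial\psi}\,e^{-m\phi-\psi}\,d\lambda ,$$ provided that the right-hand side is finite. Here $\lambda$ is Lebesgue measure and $|f|^2_{i\partial\bar\partial\psi}=\sum_{j,k}\psi^{jk}f_j\overline{f_k}$, where $(\psi^{jk})$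 is the inverse of the complex Hessian of $\psi$. Then $\phi$ is plurisubharmonic on $D$; that is, $\phi$ is upper semicontinuous and its restriction to (the part in $D$ of) every complex line is subharmonic. -/

import Mathlib

open scoped ContDiff

noncomputable section

namespace CoarseEstimate

/-- The complex Euclidean space `ℂⁿ`. -/
abbrev Cn (n : ℕ) : Type := EuclideanSpace ℂ (Fin n)

variable {n : ℕ}

/-- The `j`-th vector of the standard basis of `ℂⁿ`. -/
def stdVec (j : Fin n) : Cn n := EuclideanSpace.single j 1

/-- The Wirtinger derivative `∂g/∂z_j = (∂g/∂x_j - i ∂g/∂y_j) / 2`, where `z_j = x_j + i y_j`. -/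
def partialZ (j : Fin n) (g : Cn n → ℂ) (z : Cn n) : ℂ :=
  (fderiv ℝ g z (stdVec j) - Complex.I * fderiv ℝ g z (Complex.I • stdVec j)) / 2

/-- The Wirtinger derivative `∂g/∂z̄_j = (∂g/∂x_j + i ∂g/∂y_j) / 2`, where `z_j = x_j + i y_j`. -/
def partialZBar (j : Fin n) (g : Cn n → ℂ) (z : Cn n) : ℂ :=
  (fderiv ℝ g z (stdVec j) + Complex.I * fderiv ℝ g z (Complex.I • stdVec j)) / 2

/-- The complex Hessian `(∂²ψ/∂z_j ∂z̄_k)_{j,k}`, that is, the coefficient matrix of `i∂∂̄ψ`. -/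
def complexHessian (ψ : Cn n → ℝ) (z : Cn n) : Matrix (Fin n) (Fin n) ℂ :=
  Matrix.of fun j k => partialZ j (partialZBar k fun w => (ψ w : ℂ)) z

open scoped ComplexOrder in
/-- `ψ` is a smooth strictly plurisubharmonic function on the open set `D`: it is `C^∞` on `D` and
`i∂∂̄ψ` is positive definite at every point of `D`. -/
def IsSmoothStrictlyPSHOn (ψ : Cn n → ℝ) (D : Set (Cn n)) : Prop :=
  ContDiffOn ℝ ∞ ψ D ∧ ∀ z ∈ D, (complexHessian ψ z).PosDef

/-- The coefficients `f = (f_1, …, f_n)` define a smooth `∂̄`-closed `(0,1)`-form `∑ f_j dz̄_j`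
with compact support in `D` (a form on `D` with compact support, extended by zero to `ℂⁿ`). -/
structure IsDbarClosedTestForm (f : Cn n → Fin n → ℂ) (D : Set (Cn n)) : Prop where
  smooth : ContDiff ℝ ∞ f
  compactSupport : HasCompactSupport f
  support_subset : tsupport f ⊆ D
  closed : ∀ (z : Cn n) (j k : Fin n),
    partialZBar j (fun w => f w k) z = partialZBar k (fun w => f w j) z

/-- The length at `z` of the `(0,1)`-form `f = ∑ f_j dz̄_j` with respect to the metric `i∂∂̄ψ`:
`|f|² = ∑_{j,k} ψ^{jk} f_j conj(f_k)`, where `(ψ^{jk})` is the inverse of the complex Hessian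
of `ψ`. -/
def formNorm (ψ : Cn n → ℝ) (f : Cn n → Fin n → ℂ) (z : Cn n) : ℝ :=
  Real.sqrt (∑ j, ∑ k, (complexHessian ψ z)⁻¹ j k * f z j * (starRingEnd ℂ) (f z k)).re

/-- The function `u` is a (classical, `C¹`) solution of `∂̄u = f` on the open set `D`. -/
def SolvesDbarOn (u : Cn n → ℂ) (f : Cn n → Fin n → ℂ) (D : Set (Cn n)) : Prop :=
  ContDiffOn ℝ 1 u D ∧ ∀ z ∈ D, ∀ j, partialZBar j u z = f z j

/-- The weighted integral `∫_D h^p e^{-mφ-ψ}` with respect to Lebesgue measure,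
for `h ≥ 0`, as an element of `[0, ∞]`. -/
def weightedIntegral (D : Set (Cn n)) (p : ℝ) (m : ℕ) (φ ψ h : Cn n → ℝ) : ENNReal :=
  ∫⁻ z in D, ENNReal.ofReal (h z ^ p * Real.exp (-(m * φ z) - ψ z))

/-- The multiple coarse `L^p`-estimate property of `φ` on `D`. The constants `C m` depend on `m`
only, not on `f` and `ψ`. -/
def MultipleCoarseEstimateProperty (p : ℝ) (D : Set (Cn n)) (φ : Cn n → ℝ) : Prop :=
  ∃ C : ℕ → ℝ, (∀ m, 1 ≤ m → 0 < C m) ∧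
    Filter.Tendsto (fun m : ℕ => Real.log (C m) / m) Filter.atTop (nhds 0) ∧
    ∀ m : ℕ, 1 ≤ m → ∀ f : Cn n → Fin n → ℂ, IsDbarClosedTestForm f D →
      ∀ ψ : Cn n → ℝ, IsSmoothStrictlyPSHOn ψ D →
        weightedIntegral D p m φ ψ (formNorm ψ f) ≠ ⊤ →
        ∃ u : Cn n → ℂ, SolvesDbarOn u f D ∧
          weightedIntegral D p m φ ψ (fun z => ‖u z‖) ≤
            ENNReal.ofReal (C m) * weightedIntegral D p m φ ψ (formNorm ψ f)

/-- A real-valued function `v` is subharmonic on the open set `U ⊆ ℂ`: it is upper semicontinuous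
and satisfies the sub-mean value inequality on the boundary of every closed disc in `U`. (A
subharmonic function which is finite at the centre of the disc is integrable on the circle.) -/
def IsSubharmonicOn (v : ℂ → ℝ) (U : Set ℂ) : Prop :=
  UpperSemicontinuousOn v U ∧ ∀ (c : ℂ) (r : ℝ), 0 < r → Metric.closedBall c r ⊆ U →
    CircleIntegrable v c r ∧ v c ≤ Real.circleAverage v c r

/-- A real-valued function `φ` is plurisubharmonic on the open set `D ⊆ ℂⁿ`: it is upper
semicontinuous and its restriction to every complex line is subharmonic. -/
def IsPlurisubharmonicOn (φ : Cn n → ℝ) (D : Set (Cn n)) : Prop :=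
  UpperSemicontinuousOn φ D ∧ ∀ a b : Cn n,
    IsSubharmonicOn (fun ζ : ℂ => φ (a + ζ • b)) {ζ : ℂ | a + ζ • b ∈ D}

end CoarseEstimate

end

open scoped ContDiff
open MeasureTheory Metric Set

namespace CoarseEstimate

/-! The estimate produces holomorphic functions `F`, one for each `m`, with `‖F w‖ ≥ 1/2` and, away
from `w`, `‖F z‖ ^ p ≤ K * C m * exp (m * (φ z - φ w + 2δ))`, where `K` is independent of `m`. Along
a complex line through `w` the function `log ‖F‖` has the sub-mean value property, so `p * log (1/2)
≤ log K + log (C m) + m * (average of φ - φ w + 2δ)`. Division by `m` and `m → ∞` remove `K` and `C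
m`, and `δ → 0` gives the sub-mean value inequality for `φ`.

To build `F`, take a cutoff `χ` equal to 1 near `w`, solve `∂̄u = ∂̄χ` with the weight `ψ = |z-w|² +
(n+1) log(|z-w|² + ε²)`, and put `F = χ - u`. The Hessian of `ψ` is at least the identity and `∂̄χ`
vanishes near `w`, so the right-hand side is bounded uniformly in `ε`. On the ball of radius `ε`
about `w` the weight `e^{-ψ}` is of order `ε^{-2(n+1)}` and the volume of order `ε^{2n}`; the mean
value inequality for `|u|^p` then gives `‖u w‖ ^ p = O(ε²)` for fixed `m`. Off the support of `χ`
the same inequality, on balls of fixed radius, yields the growth bound. The core is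
`exists_holomorphic_of_coarseEstimate`; `le_circleAverage_of_coarseEstimate` passes to the limit. -/

/-! ### Mean value inequalities for `|u|^p` and for `log |f|`. -/

theorem enorm_rpow_le_lintegral_circleMap {h : ℂ → ℂ} {c : ℂ} {R p : ℝ} (hp : 1 ≤ p)
    (hd : DiffContOnCl ℂ h (ball c |R|)) :
    ENNReal.ofReal (2 * Real.pi) * ‖h c‖ₑ ^ p ≤
      ∫⁻ θ in Ioc 0 (2 * Real.pi), ‖h (circleMap c R θ)‖ₑ ^ p := by
  rcases eq_or_ne R 0 with rfl | hR
  · simp [mul_comm]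
  have hT : 0 < 2 * Real.pi := by positivity
  have hp0 : 0 < p := by linarith
  set T := ENNReal.ofReal (2 * Real.pi) with hTdef
  have hT0 : T ≠ 0 := by simpa [hTdef] using Real.pi_pos
  have hTt : T ≠ ⊤ := ENNReal.ofReal_ne_top
  have hcont : Continuous fun θ => h (circleMap c R θ) := by
    have hco := hd.continuousOn
    rw [closure_ball _ (by simpa using hR)] at hco
    exact hco.comp_continuous (continuous_circleMap c R)
      fun θ => sphere_subset_closedBall (circleMap_mem_sphere' c R θ)
  have hint : (2 * Real.pi : ℂ) * h c = ∫ θ in Ioc 0 (2 * Real.pi), h (circleMap c R θ) := by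
    have h1 := hd.circleAverage
    rw [Real.circleAverage_def, intervalIntegral.integral_of_le hT.le] at h1
    rw [← h1, Complex.real_smul]
    push_cast
    field_simp
  have h1 : T * ‖h c‖ₑ ≤ ∫⁻ θ in Ioc 0 (2 * Real.pi), ‖h (circleMap c R θ)‖ₑ := by
    calc T * ‖h c‖ₑ = ‖(2 * Real.pi : ℂ) * h c‖ₑ := by
          rw [enorm_mul]
          congr 1
          rw [hTdef, ← ofReal_norm]
          congr 1
          simp [abs_of_pos Real.pi_pos]
      _ ≤ _ := by
          rw [hint]
          exact enorm_integral_le_lintegral_enorm _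
  -- Hölder on an interval of length `T`; after raising to the power `p` it costs the factor `T ^ (p
  -- - 1)`, which is cancelled at the end.
  have h2 := eLpNorm'_le_eLpNorm'_mul_rpow_measure_univ (p := 1) (q := p)
    (μ := volume.restrict (Ioc 0 (2 * Real.pi))) one_pos hp hcont.aestronglyMeasurable
  simp only [eLpNorm'_eq_lintegral_enorm, ENNReal.rpow_one, div_one, Measure.restrict_apply_univ,
    Real.volume_Ioc, sub_zero, ← hTdef] at h2
  have h3 := ENNReal.rpow_le_rpow (h1.trans h2) hp0.le
  rw [ENNReal.mul_rpow_of_nonneg _ _ hp0.le, ENNReal.mul_rpow_of_nonneg _ _ hp0.le,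
    ← ENNReal.rpow_mul, ← ENNReal.rpow_mul, one_div_mul_cancel hp0.ne', ENNReal.rpow_one,
    sub_mul, one_div_mul_cancel hp0.ne', one_mul] at h3
  have h4 : T ^ p = T ^ (p - 1) * T := by
    rw [ENNReal.rpow_sub _ _ hT0 hTt, ENNReal.rpow_one, ENNReal.div_mul_cancel hT0 hTt]
  have h5 : T ^ (p - 1) ≠ 0 := by simp [hT0, hTt]
  have h6 : T ^ (p - 1) ≠ ⊤ := ENNReal.rpow_ne_top_of_nonneg (by linarith) hTt
  rw [h4, mul_assoc, mul_comm _ (T ^ (p - 1))] at h3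
  exact (ENNReal.mul_le_mul_iff_right h5 h6).1 h3

theorem setLIntegral_ball_comp_smul {n : ℕ} (g : Cn n → ENNReal) (t : ℝ) {c : ℂ} (hc : ‖c‖ = 1) :
    ∫⁻ y in ball 0 t, g (c • y) = ∫⁻ y in ball 0 t, g y := by
  have hc0 : c ≠ 0 := by rintro rfl; simp at hc
  let L : Cn n ≃ₗᵢ[ℝ] Cn n :=
    { (LinearEquiv.smulOfNeZero ℂ (Cn n) c hc0).restrictScalars ℝ with
      norm_map' := fun y => by
        change ‖c • y‖ = ‖y‖
        rw [norm_smul, hc, one_mul] }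
  have hL : ∀ y, L y = c • y := fun _ => rfl
  have h1 := L.measurePreserving.setLIntegral_comp_preimage_emb
    L.toHomeomorph.measurableEmbedding g (ball 0 t)
  have h2 : L ⁻¹' ball 0 t = ball 0 t := by
    ext y
    simp
  rw [h2] at h1
  exact h1

/-- Apply the circle inequality to `ζ ↦ u (z + ζ • y)` on the unit circle, integrate over `y` in the
ball and swap the integrals. Rotation by `e^{iθ}` preserves the ball and its measure, so every `θ`
contributes the same integral. -/
theorem enorm_rpow_mul_volume_ball_le {n : ℕ} {u : Cn n → ℂ} {z : Cn n} {t p : ℝ} (hp : 1 ≤ p)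
    (hu : DifferentiableOn ℂ u (ball z t)) :
    ‖u z‖ₑ ^ p * volume (ball z t) ≤ ∫⁻ y in ball z t, ‖u y‖ₑ ^ p := by
  have hp0 : 0 < p := by linarith
  set T := ENNReal.ofReal (2 * Real.pi) with hTdef
  have hT0 : T ≠ 0 := by simpa [hTdef] using Real.pi_pos
  have hTt : T ≠ ⊤ := ENNReal.ofReal_ne_top
  have htrans : ∫⁻ y in ball z t, ‖u y‖ₑ ^ p = ∫⁻ y in ball 0 t, ‖u (z + y)‖ₑ ^ p := by
    have h1 := (measurePreserving_add_left (volume : Measure (Cn n)) z).setLIntegral_comp_preimage_emb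
      (Homeomorph.addLeft z).measurableEmbedding (fun y => ‖u y‖ₑ ^ p) (ball z t)
    rw [← h1]
    simp [preimage_add_ball]
  have hmem : ∀ y ∈ ball (0 : Cn n) t, ∀ ζ : ℂ, ‖ζ‖ ≤ 1 → z + ζ • y ∈ ball z t := by
    intro y hy ζ hζ
    rw [mem_ball_zero_iff] at hy
    rw [mem_ball_iff_norm, add_sub_cancel_left, norm_smul]
    nlinarith [norm_nonneg y]
  have hpt : ∀ y ∈ ball (0 : Cn n) t, T * ‖u z‖ₑ ^ p ≤
      ∫⁻ θ in Ioc 0 (2 * Real.pi), ‖u (z + circleMap 0 1 θ • y)‖ₑ ^ p := by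
    intro y hy
    have hd : DifferentiableOn ℂ (fun ζ : ℂ => u (z + ζ • y)) (closedBall 0 1) := by
      refine hu.comp (f := fun ζ : ℂ => z + ζ • y) (by fun_prop) fun ζ hζ => hmem y hy ζ ?_
      simpa using hζ
    have hd' : DiffContOnCl ℂ (fun ζ : ℂ => u (z + ζ • y)) (ball 0 |1|) := by
      rw [abs_one]
      refine DifferentiableOn.diffContOnCl ?_
      rwa [closure_ball _ one_ne_zero]
    simpa only [zero_smul, add_zero] using enorm_rpow_le_lintegral_circleMap hp hd'
  have hmeas : AEMeasurable (Function.uncurry fun (y : Cn n) (θ : ℝ) =>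
      ‖u (z + circleMap 0 1 θ • y)‖ₑ ^ p)
      ((volume.restrict (ball 0 t)).prod (volume.restrict (Ioc 0 (2 * Real.pi)))) := by
    rw [Measure.prod_restrict]
    have hc : ContinuousOn (fun q : Cn n × ℝ => u (z + circleMap 0 1 q.2 • q.1))
        (ball 0 t ×ˢ Ioc 0 (2 * Real.pi)) := by
      refine hu.continuousOn.comp ?_ fun q hq => hmem q.1 hq.1 _ (by simp)
      have := continuous_circleMap 0 1
      fun_prop
    exact (hc.aemeasurable (measurableSet_ball.prod measurableSet_Ioc)).enorm.pow_const p
  have hvol : volume (ball z t) = volume (ball (0 : Cn n) t) :=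
    Measure.addHaar_ball_center _ _ _
  have key : T * (‖u z‖ₑ ^ p * volume (ball z t)) ≤ T * ∫⁻ y in ball z t, ‖u y‖ₑ ^ p := by
    calc T * (‖u z‖ₑ ^ p * volume (ball z t))
        = ∫⁻ y in ball (0 : Cn n) t, T * ‖u z‖ₑ ^ p := by
          rw [setLIntegral_const, hvol, mul_assoc]
      _ ≤ ∫⁻ y in ball (0 : Cn n) t,
            ∫⁻ θ in Ioc 0 (2 * Real.pi), ‖u (z + circleMap 0 1 θ • y)‖ₑ ^ p :=
          setLIntegral_mono' measurableSet_ball hpt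
      _ = ∫⁻ θ in Ioc 0 (2 * Real.pi),
            ∫⁻ y in ball (0 : Cn n) t, ‖u (z + circleMap 0 1 θ • y)‖ₑ ^ p :=
          lintegral_lintegral_swap hmeas
      _ = ∫⁻ θ in Ioc 0 (2 * Real.pi), ∫⁻ y in ball (0 : Cn n) t, ‖u (z + y)‖ₑ ^ p := by
          refine lintegral_congr fun θ => ?_
          exact setLIntegral_ball_comp_smul (fun y => ‖u (z + y)‖ₑ ^ p) t (by simp)
      _ = T * ∫⁻ y in ball z t, ‖u y‖ₑ ^ p := by
          rw [setLIntegral_const, htrans, Real.volume_Ioc, sub_zero, mul_comm]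
  exact (ENNReal.mul_le_mul_iff_right hT0 hTt).1 key

/-- Jensen's formula: each zero `a` in the disc adds a nonnegative multiple of `log (R / ‖c - a‖)`.
-/
theorem log_norm_le_circleAverage {f : ℂ → ℂ} {c : ℂ} {R : ℝ} (hR : 0 < R)
    (hf : AnalyticOnNhd ℂ f (closedBall c R)) (hc : f c ≠ 0) :
    Real.log ‖f c‖ ≤ Real.circleAverage (fun z => Real.log ‖f z‖) c R := by
  rw [← abs_of_pos hR] at hf
  rw [hf.circleAverage_log_norm hR.ne' hc]
  refine le_add_of_nonneg_left (finsum_nonneg fun a => ?_)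
  by_cases ha : a ∈ closedBall c |R|
  · refine mul_nonneg (mod_cast MeromorphicOn.AnalyticOnNhd.divisor_nonneg hf a) ?_
    rcases eq_or_ne a c with rfl | hac
    · simp
    · refine Real.log_nonneg ?_
      rw [mem_closedBall_iff_norm', abs_of_pos hR] at ha
      have : 0 < ‖c - a‖ := norm_pos_iff.2 (sub_ne_zero.2 hac.symm)
      rwa [← div_eq_mul_inv, le_div_iff₀ this, one_mul]
  · simp [ha]

/-- Since `Real.log 0 = 0`, the bound by `G` may fail at zeros of `f` on the circle, hence the
restriction in `hle`. These zeros do not affect the average, so the integrand is replaced by `G`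
there. -/
theorem log_norm_le_circleAverage_of_norm_le_exp {f : ℂ → ℂ} {G : ℂ → ℝ} {c : ℂ} {R : ℝ}
    (hR : 0 < R) (hf : AnalyticOnNhd ℂ f (closedBall c R)) (hc : f c ≠ 0)
    (hG : CircleIntegrable G c R) (hle : ∀ z ∈ sphere c R, f z ≠ 0 → Real.log ‖f z‖ ≤ G z) :
    Real.log ‖f c‖ ≤ Real.circleAverage G c R := by
  classical
  refine (log_norm_le_circleAverage hR hf hc).trans ?_
  have hcd : f ⁻¹' {0}ᶜ ∈ Filter.codiscreteWithin (sphere c |R|) := by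
    rw [abs_of_pos hR]
    exact Filter.codiscreteWithin_mono sphere_subset_closedBall
      (hf.preimage_zero_mem_codiscreteWithin hc (mem_closedBall_self hR.le)
        ((convex_closedBall c R).isConnected ⟨c, mem_closedBall_self hR.le⟩))
  have heq : (fun z => Real.log ‖f z‖) =ᶠ[Filter.codiscreteWithin (sphere c |R|)]
      fun z => if f z = 0 then G z else Real.log ‖f z‖ := by
    filter_upwards [hcd] with z hz
    exact (if_neg hz).symm
  have hint : CircleIntegrable (fun z => Real.log ‖f z‖) c R :=
    (hf.mono sphere_subset_closedBall).meromorphicOn.circleIntegrable_log_norm_of_nonneg hR.le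
  rw [Real.circleAverage_congr_codiscreteWithin heq hR.ne']
  refine Real.circleAverage_mono (hint.congr_codiscreteWithin heq) hG fun z hz => ?_
  rw [abs_of_pos hR] at hz
  split_ifs with h0
  · exact le_rfl
  · exact hle z hz h0

/-! ### Wirtinger derivatives and complex Hessians of radial functions. -/

variable {n : ℕ}

theorem stdVec_apply (j k : Fin n) : stdVec j k = if j = k then 1 else 0 := by
  simp [stdVec, eq_comm]

theorem hasFDerivAt_norm_sub_sq (w z : Cn n) :
    HasFDerivAt (fun y : Cn n => ‖y - w‖ ^ 2) (2 • innerSL ℝ (z - w)) z := by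
  simpa using ((hasFDerivAt_id (𝕜 := ℝ) z).sub_const w).norm_sq

theorem real_inner_stdVec (x : Cn n) (k : Fin n) : inner ℝ x (stdVec k) = (x k).re := by
  simp [PiLp.inner_apply, stdVec, Complex.inner, apply_ite]

theorem real_inner_I_smul_stdVec (x : Cn n) (k : Fin n) :
    inner ℝ x (Complex.I • stdVec k) = (x k).im := by
  simp [PiLp.inner_apply, stdVec, Complex.inner, apply_ite]

theorem hasFDerivAt_ofReal_comp_norm_sub_sq {g : ℝ → ℝ} {a : ℝ} (w z : Cn n)
    (hg : HasDerivAt g a (‖z - w‖ ^ 2)) :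
    HasFDerivAt (fun y : Cn n => (g (‖y - w‖ ^ 2) : ℂ))
      (Complex.ofRealCLM.comp (a • (2 • innerSL ℝ (z - w)))) z :=
  Complex.ofRealCLM.hasFDerivAt.comp z
    (hg.comp_hasFDerivAt z (hasFDerivAt_norm_sub_sq w z))

theorem partialZBar_radial {g : ℝ → ℝ} {a : ℝ} (w z : Cn n) (k : Fin n)
    (hg : HasDerivAt g a (‖z - w‖ ^ 2)) :
    partialZBar k (fun y : Cn n => (g (‖y - w‖ ^ 2) : ℂ)) z = a * (z - w) k := by
  rw [partialZBar, (hasFDerivAt_ofReal_comp_norm_sub_sq w z hg).fderiv]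
  simp only [ContinuousLinearMap.comp_apply, _root_.smul_apply, innerSL_apply_apply,
    real_inner_stdVec, real_inner_I_smul_stdVec, Complex.ofRealCLM_apply]
  conv_rhs => rw [← Complex.re_add_im ((z - w) k)]
  simp only [smul_eq_mul, nsmul_eq_mul]
  push_cast
  ring

theorem partialZ_radial_mul {g : ℝ → ℝ} {a : ℝ} (w z : Cn n) (j k : Fin n)
    (hg : HasDerivAt g a (‖z - w‖ ^ 2)) :
    partialZ j (fun y : Cn n => (g (‖y - w‖ ^ 2) : ℂ) * (y - w) k) z =
      (if j = k then (g (‖z - w‖ ^ 2) : ℂ) else 0)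
        + a * ((z - w) k * (starRingEnd ℂ) ((z - w) j)) := by
  have h1 : HasFDerivAt (fun y : Cn n => (y - w) k)
      ((EuclideanSpace.proj k : Cn n →L[ℂ] ℂ).restrictScalars ℝ) z :=
    (((EuclideanSpace.proj k : Cn n →L[ℂ] ℂ).restrictScalars ℝ).hasFDerivAt
      (x := z)).sub_const (w k)
  rw [partialZ, ((hasFDerivAt_ofReal_comp_norm_sub_sq w z hg).fun_mul h1).fderiv]
  have h2 : (starRingEnd ℂ) ((z - w) j) = ((z - w) j).re - ((z - w) j).im * Complex.I := by
    generalize (z - w) j = a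
    apply Complex.ext <;> simp
  have h4 : ∀ v : Cn n, (EuclideanSpace.proj k : Cn n →L[ℂ] ℂ) v = v k := fun _ => rfl
  rw [h2]
  simp only [_root_.add_apply, ContinuousLinearMap.comp_apply,
    _root_.smul_apply, innerSL_apply_apply,
    real_inner_stdVec, real_inner_I_smul_stdVec, Complex.ofRealCLM_apply,
    ContinuousLinearMap.coe_restrictScalars', h4, PiLp.smul_apply, stdVec_apply,
    smul_eq_mul, nsmul_eq_mul]
  split_ifs
  all_goals
    push_cast
    ring_nf
    try rw [Complex.I_sq]
    try ring

/-- The derivative `g₁` is needed on all of `[0, ∞)` because the inner Wirtinger derivative is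
differentiated again; the second derivative `a` matters only at one point. -/
theorem complexHessian_radial {g g₁ : ℝ → ℝ} {a : ℝ} (w z : Cn n)
    (hg : ∀ t, 0 ≤ t → HasDerivAt g (g₁ t) t) (hg₁ : HasDerivAt g₁ a (‖z - w‖ ^ 2)) :
    complexHessian (fun y : Cn n => g (‖y - w‖ ^ 2)) z =
      (g₁ (‖z - w‖ ^ 2) : ℂ) • (1 : Matrix (Fin n) (Fin n) ℂ)
        + (a : ℂ) • Matrix.vecMulVec (star (z - w).ofLp) (z - w).ofLp := by
  ext j k
  have h1 : partialZBar k (fun y : Cn n => ((g (‖y - w‖ ^ 2) : ℝ) : ℂ)) =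
      fun y => (g₁ (‖y - w‖ ^ 2) : ℂ) * (y - w) k :=
    funext fun y => partialZBar_radial w y k (hg _ (by positivity))
  rw [complexHessian, Matrix.of_apply, h1, partialZ_radial_mul w z j k hg₁]
  simp [Matrix.one_apply, Matrix.vecMulVec_apply, mul_comm]

/-! ### Comparison of `formNorm` with the Euclidean norm. -/

open Matrix in
/-- If `H ≥ 1`, then `H⁻¹ ≤ 1`. -/
theorem re_star_dotProduct_inv_mulVec_le {H : Matrix (Fin n) (Fin n) ℂ} (hH : IsUnit H.det)
    (h1 : ∀ x : Fin n → ℂ, (star x ⬝ᵥ x).re ≤ (star x ⬝ᵥ H *ᵥ x).re) (g : Fin n → ℂ) :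
    (star g ⬝ᵥ H⁻¹ *ᵥ g).re ≤ (star g ⬝ᵥ g).re := by
  set x := H⁻¹ *ᵥ g with hx
  have hg : H *ᵥ x = g := by rw [hx, mulVec_mulVec, mul_nonsing_inv _ hH, one_mulVec]
  have h2 := h1 x
  rw [hg] at h2
  -- Expanding `|g - x|² ≥ 0` gives `2 Re⟨x, g⟩ ≤ |g|² + |x|²`, and `h2` reads `|x|² ≤ Re⟨x, g⟩`.
  have h3 : 0 ≤ (star (g - x) ⬝ᵥ (g - x)).re := by
    simp only [dotProduct, Complex.re_sum]
    refine Finset.sum_nonneg fun i _ => ?_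
    simp only [Pi.star_apply, Complex.star_def, Complex.mul_re, Complex.conj_re, Complex.conj_im]
    nlinarith [sq_nonneg ((g - x) i).re, sq_nonneg ((g - x) i).im]
  have h4 : (star x ⬝ᵥ g).re = (star g ⬝ᵥ x).re := by
    simp only [dotProduct, Complex.re_sum]
    refine Finset.sum_congr rfl fun i _ => ?_
    simp [Complex.mul_re]
    ring
  simp only [star_sub, sub_dotProduct, dotProduct_sub, Complex.sub_re] at h3
  linarith

theorem formNorm_le {ψ : Cn n → ℝ} {z : Cn n} (hH : IsUnit (complexHessian ψ z).det)
    (h1 : ∀ x : Fin n → ℂ,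
      (star x ⬝ᵥ x).re ≤ (star x ⬝ᵥ Matrix.mulVec (complexHessian ψ z) x).re)
    (f : Cn n → Fin n → ℂ) : formNorm ψ f z ≤ Real.sqrt (∑ j, ‖f z j‖ ^ 2) := by
  refine Real.sqrt_le_sqrt ?_
  -- In `formNorm` the conjugate falls on the column index, so the quadratic form is evaluated at
  -- the conjugate of `f z`.
  have h2 := re_star_dotProduct_inv_mulVec_le hH h1 (star (f z))
  rw [star_star] at h2
  refine le_trans (le_of_eq ?_) (h2.trans (le_of_eq ?_))
  · congr 1
    simp only [dotProduct, Matrix.mulVec, Finset.mul_sum, Pi.star_apply,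
      Complex.star_def]
    refine Finset.sum_congr rfl fun i _ => Finset.sum_congr rfl fun j _ => ?_
    ring
  · simp only [dotProduct, Complex.re_sum, Pi.star_apply, Complex.star_def,
      Complex.mul_conj, Complex.normSq_eq_norm_sq, Complex.ofReal_re]

/-! ### The weights with an approximate logarithmic pole at `w`. -/

/-- The radial weight `|z-w|² + (n+1) log(|z-w|² + ε²)`. -/
noncomputable def logWeight (w : Cn n) (ε : ℝ) (z : Cn n) : ℝ :=
  ‖z - w‖ ^ 2 + (n + 1) * Real.log (‖z - w‖ ^ 2 + ε ^ 2)

theorem complexHessian_logWeight (w z : Cn n) {ε : ℝ} (hε : 0 < ε) :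
    complexHessian (logWeight w ε) z =
      ((1 + (n + 1) * (‖z - w‖ ^ 2 + ε ^ 2)⁻¹ : ℝ) : ℂ) • (1 : Matrix (Fin n) (Fin n) ℂ)
        + ((-((n + 1) * ((‖z - w‖ ^ 2 + ε ^ 2) ^ 2)⁻¹) : ℝ) : ℂ) •
          Matrix.vecMulVec (star (z - w).ofLp) (z - w).ofLp := by
  have hpos : ∀ t : ℝ, 0 ≤ t → t + ε ^ 2 ≠ 0 := fun t ht => by positivity
  refine complexHessian_radial (g := fun t => t + (n + 1) * Real.log (t + ε ^ 2))
    (g₁ := fun t => 1 + (n + 1) * (t + ε ^ 2)⁻¹) w z (fun t ht => ?_) ?_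
  · have := (((hasDerivAt_id t).add_const (ε ^ 2)).log (hpos t ht)).const_mul ((n : ℝ) + 1)
    exact ((hasDerivAt_id t).add this).congr_deriv (by simp)
  · have h := ((((hasDerivAt_id (‖z - w‖ ^ 2)).add_const (ε ^ 2)).inv
      (hpos _ (sq_nonneg _))).const_mul ((n : ℝ) + 1)).const_add 1
    refine h.congr_deriv ?_
    simp only [id]
    ring

open Matrix in
theorem re_dotProduct_vecMulVec_le (v : Cn n) (x : Fin n → ℂ) :
    (star x ⬝ᵥ vecMulVec (star v.ofLp) v.ofLp *ᵥ x).re ≤ ‖v‖ ^ 2 * (star x ⬝ᵥ x).re := by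
  have hxx : (star x ⬝ᵥ x).re = ‖WithLp.toLp 2 x‖ ^ 2 := by
    rw [EuclideanSpace.norm_sq_eq]
    simp only [dotProduct, Complex.re_sum, Pi.star_apply, Complex.star_def, mul_comm,
      Complex.mul_conj, Complex.normSq_eq_norm_sq, Complex.ofReal_re]
  have hcs := norm_inner_le_norm (𝕜 := ℂ) (WithLp.toLp 2 (star v.ofLp)) (WithLp.toLp 2 x)
  have hv : ‖WithLp.toLp 2 (star v.ofLp)‖ = ‖v‖ := by
    simp [EuclideanSpace.norm_eq]
  have hin : inner ℂ (WithLp.toLp 2 (star v.ofLp)) (WithLp.toLp 2 x) = v.ofLp ⬝ᵥ x := by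
    simp [PiLp.inner_apply, dotProduct, mul_comm]
  rw [hin, hv] at hcs
  have hs : star x ⬝ᵥ star v.ofLp = star (v.ofLp ⬝ᵥ x) := by
    rw [star_dotProduct_star, dotProduct_comm]
  rw [vecMulVec_mulVec, hxx]
  have h2 : (star x ⬝ᵥ MulOpposite.op (v.ofLp ⬝ᵥ x) • star v.ofLp).re = ‖v.ofLp ⬝ᵥ x‖ ^ 2 := by
    rw [dotProduct_smul, hs, MulOpposite.smul_eq_mul_unop, MulOpposite.unop_op, Complex.star_def,
      mul_comm, Complex.mul_conj, Complex.ofReal_re, Complex.normSq_eq_norm_sq]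
  rw [h2, ← mul_pow]
  gcongr

-- With `A = ‖z - w‖² + ε²`, the negative rank-one term is at most `(n+1) ‖z - w‖² / A² ≤ (n+1) / A`
-- in size, so the scalar part of the Hessian of the logarithm absorbs it. The identity coming from
-- `‖z - w‖²` remains, whatever `ε` is.
open Matrix in
theorem re_star_dotProduct_le_complexHessian_logWeight (w z : Cn n) {ε : ℝ} (hε : 0 < ε)
    (x : Fin n → ℂ) :
    (star x ⬝ᵥ x).re ≤ (star x ⬝ᵥ complexHessian (logWeight w ε) z *ᵥ x).re := by
  rw [complexHessian_logWeight w z hε, add_mulVec, smul_mulVec, smul_mulVec, one_mulVec,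
    dotProduct_add, dotProduct_smul, dotProduct_smul, smul_eq_mul, smul_eq_mul, Complex.add_re,
    Complex.re_ofReal_mul, Complex.re_ofReal_mul]
  have h1 := re_dotProduct_vecMulVec_le (z - w) x
  have h0 : 0 ≤ (star x ⬝ᵥ x).re := by
    simp only [dotProduct, Complex.re_sum]
    refine Finset.sum_nonneg fun i _ => ?_
    simp only [Pi.star_apply, Complex.star_def, Complex.mul_re, Complex.conj_re, Complex.conj_im]
    nlinarith [sq_nonneg (x i).re, sq_nonneg (x i).im]
  set A := ‖z - w‖ ^ 2 + ε ^ 2 with hA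
  have hA0 : 0 < A := by positivity
  have h2 : ‖z - w‖ ^ 2 * (star x ⬝ᵥ x).re ≤ A * (star x ⬝ᵥ x).re := by
    gcongr
    nlinarith
  have h3 := mul_le_mul_of_nonneg_left (h1.trans h2)
    (show (0 : ℝ) ≤ (n + 1) * (A ^ 2)⁻¹ by positivity)
  have h4 : ((n : ℝ) + 1) * (A ^ 2)⁻¹ * (A * (star x ⬝ᵥ x).re) =
      (n + 1) * A⁻¹ * (star x ⬝ᵥ x).re := by
    field_simp
  linarith

open scoped ComplexOrder in
open Matrix in
theorem posDef_complexHessian_logWeight (w z : Cn n) {ε : ℝ} (hε : 0 < ε) :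
    (complexHessian (logWeight w ε) z).PosDef := by
  have hherm : (complexHessian (logWeight w ε) z).IsHermitian := by
    rw [complexHessian_logWeight w z hε]
    refine (isHermitian_one.smul (Complex.conj_ofReal _)).add
      (IsHermitian.smul ?_ (Complex.conj_ofReal _))
    rw [IsHermitian, conjTranspose_vecMulVec, star_star]
  refine PosDef.of_dotProduct_mulVec_pos hherm fun x hx => ?_
  have h1 := re_star_dotProduct_le_complexHessian_logWeight w z hε x
  have h2 := (Complex.pos_iff.1 (dotProduct_star_self_pos_iff.2 hx)).1
  exact Complex.pos_iff.2 ⟨h2.trans_le h1, (hherm.im_star_dotProduct_mulVec_self x).symm⟩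

open scoped ComplexOrder in
theorem formNorm_logWeight_le (w z : Cn n) {ε : ℝ} (hε : 0 < ε) (f : Cn n → Fin n → ℂ) :
    formNorm (logWeight w ε) f z ≤ Real.sqrt (∑ j, ‖f z j‖ ^ 2) :=
  formNorm_le ((Matrix.isUnit_iff_isUnit_det _).1 (posDef_complexHessian_logWeight w z hε).isUnit)
    (re_star_dotProduct_le_complexHessian_logWeight w z hε) f

theorem contDiff_logWeight (w : Cn n) {ε : ℝ} (hε : 0 < ε) : ContDiff ℝ ∞ (logWeight w ε) := by
  have h1 : ContDiff ℝ ∞ fun z : Cn n => ‖z - w‖ ^ 2 := (contDiff_id.sub contDiff_const).norm_sq ℝ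
  exact h1.add (contDiff_const.mul ((h1.add contDiff_const).log fun z => by positivity))

theorem isSmoothStrictlyPSHOn_logWeight (w : Cn n) {ε : ℝ} (hε : 0 < ε) (D : Set (Cn n)) :
    IsSmoothStrictlyPSHOn (logWeight w ε) D :=
  ⟨(contDiff_logWeight w hε).contDiffOn, fun z _ => posDef_complexHessian_logWeight w z hε⟩

/-! ### The form `∂̄χ` and the Cauchy–Riemann equations. -/

theorem isDbarClosedTestForm_partialZBar {χ : Cn n → ℂ} {D : Set (Cn n)} (hχ : ContDiff ℝ ∞ χ)
    (hc : HasCompactSupport χ) (hD : tsupport χ ⊆ D) :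
    IsDbarClosedTestForm (fun z j => partialZBar j χ z) D := by
  have hd : ContDiff ℝ ∞ (fderiv ℝ χ) := hχ.fderiv_right le_rfl
  have hsub : tsupport (fun z j => partialZBar j χ z) ⊆ tsupport χ := by
    refine closure_minimal (fun z hz => ?_) (isClosed_tsupport χ)
    by_contra hz'
    have h0 : fderiv ℝ χ z = 0 := by
      by_contra h1
      exact hz' (support_fderiv_subset ℝ h1)
    exact hz (funext fun j => by simp [partialZBar, h0])
  refine ⟨?_, ?_, hsub.trans hD, fun z j k => ?_⟩
  · refine contDiff_pi.2 fun j => ?_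
    simp only [partialZBar]
    exact ((hd.clm_apply contDiff_const).add
      (contDiff_const.mul (hd.clm_apply contDiff_const))).div_const _
  · exact hc.of_isClosed_subset (isClosed_tsupport _) hsub
  · have hdd : HasFDerivAt (fderiv ℝ χ) (fderiv ℝ (fderiv ℝ χ) z) z :=
      (hd.differentiable (by simp) z).hasFDerivAt
    have h1 : ∀ v : Cn n, HasFDerivAt (fun y => fderiv ℝ χ y v)
        ((ContinuousLinearMap.apply ℝ ℂ v).comp (fderiv ℝ (fderiv ℝ χ) z)) z := fun v =>
      (ContinuousLinearMap.apply ℝ ℂ v).hasFDerivAt.comp z hdd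
    have h2 : ∀ (k : Fin n) (v : Cn n), fderiv ℝ (fun y => partialZBar k χ y) z v =
        (fderiv ℝ (fderiv ℝ χ) z v (stdVec k)
          + Complex.I * fderiv ℝ (fderiv ℝ χ) z v (Complex.I • stdVec k)) / 2 := fun k v => by
      have h3 := ((h1 (stdVec k)).add ((h1 (Complex.I • stdVec k)).const_mul Complex.I)).mul_const
        (2 : ℂ)⁻¹
      have h4 : HasFDerivAt (fun y => partialZBar k χ y) _ z := h3
      rw [h4.fderiv]
      simp [div_eq_mul_inv, mul_comm, mul_add]
    have hsymm : IsSymmSndFDerivAt ℝ χ z :=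
      hχ.contDiffAt.isSymmSndFDerivAt (by
        rw [minSmoothness_of_isRCLikeNormedField]
        exact WithTop.coe_le_coe.2 le_top)
    rw [partialZBar, partialZBar, h2, h2, h2, h2, hsymm (stdVec j) (stdVec k),
      hsymm (stdVec j) (Complex.I • stdVec k), hsymm (Complex.I • stdVec j) (stdVec k),
      hsymm (Complex.I • stdVec j) (Complex.I • stdVec k)]
    ring

theorem sum_smul_stdVec (v : Cn n) : ∑ j, v j • stdVec j = v := by
  ext k
  simp [stdVec_apply]

theorem differentiableAt_complex_of_partialZBar_eq_zero {F : Cn n → ℂ} {z : Cn n}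
    (hF : DifferentiableAt ℝ F z) (h0 : ∀ j, partialZBar j F z = 0) : DifferentiableAt ℂ F z := by
  rw [differentiableAt_iff_restrictScalars ℝ hF]
  have hI : ∀ j, fderiv ℝ F z (Complex.I • stdVec j) = Complex.I * fderiv ℝ F z (stdVec j) := by
    intro j
    have h1 := h0 j
    rw [partialZBar, div_eq_zero_iff, or_iff_left two_ne_zero] at h1
    linear_combination (-Complex.I) * h1 + fderiv ℝ F z (Complex.I • stdVec j) * Complex.I_mul_I
  refine ⟨∑ j, (EuclideanSpace.proj j : Cn n →L[ℂ] ℂ).smulRight (fderiv ℝ F z (stdVec j)), ?_⟩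
  ext v
  conv_rhs => rw [← sum_smul_stdVec v, map_sum]
  simp only [ContinuousLinearMap.coe_restrictScalars', _root_.sum_apply]
  refine Finset.sum_congr rfl fun j _ => ?_
  have h1 : v j • stdVec j = (v j).re • stdVec j + (v j).im • (Complex.I • stdVec j) := by
    conv_lhs => rw [← Complex.re_add_im (v j)]
    rw [add_smul, mul_smul, Complex.coe_smul, Complex.coe_smul]
  rw [h1, map_add, map_smul, map_smul, hI]
  change v j • fderiv ℝ F z (stdVec j) = _
  conv_lhs => rw [← Complex.re_add_im (v j)]
  simp only [smul_eq_mul, Complex.real_smul]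
  ring

/-! ### Bounds for the two weighted integrals. -/

theorem exp_neg_logWeight (w z : Cn n) {ε : ℝ} (hε : 0 < ε) :
    Real.exp (-logWeight w ε z) =
      Real.exp (-‖z - w‖ ^ 2) * ((‖z - w‖ ^ 2 + ε ^ 2) ^ (n + 1))⁻¹ := by
  have hA : 0 < ‖z - w‖ ^ 2 + ε ^ 2 := by positivity
  rw [logWeight, neg_add, Real.exp_add, Real.exp_neg (_ * _), mul_comm ((n : ℝ) + 1), Real.exp_mul,
    Real.exp_log hA]
  norm_cast

/-- The form lives on the shell `s / 2 ≤ ‖y - w‖ ≤ s`, where `e^{-ψ} ≤ (s/2)^{-2(n+1)}`. The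
resulting bound does not involve `ε`, which can thus be chosen afterwards. -/
theorem weightedIntegral_formNorm_logWeight_le {D : Set (Cn n)} {φ : Cn n → ℝ} {p s ε M b : ℝ}
    {w : Cn n} {f : Cn n → Fin n → ℂ} (m : ℕ) (hp : 1 < p) (hs : 0 < s) (hε : 0 < ε)
    (hb : ∀ y ∈ closedBall w s, b ≤ φ y)
    (hM : ∀ y, Real.sqrt (∑ j, ‖f y j‖ ^ 2) ≤ M)
    (hin : ∀ y, ‖y - w‖ < s / 2 → f y = 0) (hout : ∀ y, s < ‖y - w‖ → f y = 0) :
    weightedIntegral D p m φ (logWeight w ε) (formNorm (logWeight w ε) f) ≤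
      ENNReal.ofReal (M ^ p * (Real.exp (-(m * b)) * (((s / 2) ^ 2) ^ (n + 1))⁻¹))
        * volume (closedBall w s) := by
  have hp0 : p ≠ 0 := by linarith
  have h0 : ∀ y, f y = 0 → formNorm (logWeight w ε) f y = 0 := fun y hy => by
    simp [formNorm, hy]
  have hM0 : 0 ≤ M := (Real.sqrt_nonneg _).trans (hM w)
  have hpt : ∀ y, ENNReal.ofReal (formNorm (logWeight w ε) f y ^ p
      * Real.exp (-(m * φ y) - logWeight w ε y)) ≤
      (closedBall w s).indicator (fun _ => ENNReal.ofReal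
        (M ^ p * (Real.exp (-(m * b)) * (((s / 2) ^ 2) ^ (n + 1))⁻¹))) y := by
    intro y
    by_cases hy : y ∈ closedBall w s
    · rw [indicator_of_mem hy]
      refine ENNReal.ofReal_le_ofReal ?_
      by_cases hy2 : ‖y - w‖ < s / 2
      · rw [h0 y (hin y hy2), Real.zero_rpow hp0, zero_mul]
        positivity
      · rw [not_lt] at hy2
        have h1 : formNorm (logWeight w ε) f y ≤ M := (formNorm_logWeight_le w y hε f).trans (hM y)
        have h2 : 0 ≤ formNorm (logWeight w ε) f y := Real.sqrt_nonneg _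
        rw [sub_eq_add_neg, Real.exp_add, exp_neg_logWeight w y hε]
        have h3 : Real.exp (-‖y - w‖ ^ 2) * ((‖y - w‖ ^ 2 + ε ^ 2) ^ (n + 1))⁻¹ ≤
            1 * (((s / 2) ^ 2) ^ (n + 1))⁻¹ := by
          gcongr
          · rw [Real.exp_le_one_iff]
            nlinarith [sq_nonneg ‖y - w‖]
          · nlinarith [sq_nonneg ε]
        rw [one_mul] at h3
        have h4 := hb y hy
        gcongr
    · rw [indicator_of_notMem hy, h0 y (hout y (by simpa [dist_eq_norm] using hy)),
        Real.zero_rpow hp0, zero_mul, ENNReal.ofReal_zero]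
  calc _ ≤ ∫⁻ y in D, (closedBall w s).indicator (fun _ => ENNReal.ofReal
        (M ^ p * (Real.exp (-(m * b)) * (((s / 2) ^ 2) ^ (n + 1))⁻¹))) y := lintegral_mono hpt
    _ ≤ ∫⁻ y, (closedBall w s).indicator (fun _ => ENNReal.ofReal
        (M ^ p * (Real.exp (-(m * b)) * (((s / 2) ^ 2) ^ (n + 1))⁻¹))) y :=
      setLIntegral_le_lintegral _ _
    _ = _ := by rw [lintegral_indicator_const measurableSet_closedBall]

theorem enorm_rpow_mul_volume_ball_mul_le_weightedIntegral {D : Set (Cn n)} {φ ψ : Cn n → ℝ}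
    {u : Cn n → ℂ} {z : Cn n} {p t κ : ℝ} (m : ℕ) (hp : 1 < p) (hD : ball z t ⊆ D)
    (hu : DifferentiableOn ℂ u (ball z t))
    (hw : ∀ y ∈ ball z t, κ ≤ Real.exp (-(m * φ y) - ψ y)) :
    ‖u z‖ₑ ^ p * volume (ball z t) * ENNReal.ofReal κ ≤
      weightedIntegral D p m φ ψ (fun y => ‖u y‖) := by
  have hp0 : 0 ≤ p := by linarith
  calc ‖u z‖ₑ ^ p * volume (ball z t) * ENNReal.ofReal κ
      ≤ (∫⁻ y in ball z t, ‖u y‖ₑ ^ p) * ENNReal.ofReal κ := by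
        gcongr
        exact enorm_rpow_mul_volume_ball_le hp.le hu
    _ = ∫⁻ y in ball z t, ‖u y‖ₑ ^ p * ENNReal.ofReal κ :=
        (lintegral_mul_const' _ _ ENNReal.ofReal_ne_top).symm
    _ ≤ ∫⁻ y in ball z t, ENNReal.ofReal (‖u y‖ ^ p * Real.exp (-(m * φ y) - ψ y)) := by
        refine setLIntegral_mono' measurableSet_ball fun y hy => ?_
        rw [← ofReal_norm, ENNReal.ofReal_rpow_of_nonneg (norm_nonneg _) hp0,
          ← ENNReal.ofReal_mul (by positivity)]
        have := hw y hy
        gcongr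
    _ ≤ _ := lintegral_mono_set hD

theorem exists_cutoff (w : Cn n) {s : ℝ} (hs : 0 < s) : ∃ χ : Cn n → ℂ, ContDiff ℝ ∞ χ ∧
    HasCompactSupport χ ∧ tsupport χ ⊆ closedBall w s ∧ (∀ y ∈ ball w (s / 2), χ y = 1) ∧
    ∀ y, s < ‖y - w‖ → χ y = 0 := by
  let χ : ContDiffBump w := ⟨s / 2, s, by positivity, by linarith⟩
  have hsub : tsupport (fun y => ((χ y : ℝ) : ℂ)) ⊆ closedBall w s := by
    refine (closure_mono fun y hy => ?_).trans χ.tsupport_eq.subset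
    simpa using hy
  refine ⟨fun y => (χ y : ℂ), Complex.ofRealCLM.contDiff.comp χ.contDiff, ?_, hsub,
    fun y hy => ?_, fun y hy => ?_⟩
  · exact (isCompact_closedBall w s).of_isClosed_subset (isClosed_tsupport _) hsub
  · simp [χ.one_of_mem_closedBall (ball_subset_closedBall hy)]
  · simp [χ.zero_of_le_dist (show s ≤ dist y w by rw [dist_eq_norm]; exact hy.le)]

/-! ### Construction of the holomorphic functions. -/

/-- Solving `∂̄u = ∂̄χ` with the weights `logWeight` produces holomorphic functions of
controlled growth that do not vanish at `w`. -/
theorem exists_holomorphic_of_coarseEstimate {D : Set (Cn n)} (hDo : IsOpen D) {φ : Cn n → ℝ}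
    {p : ℝ} (hp : 1 < p) {C : ℕ → ℝ} (hC : ∀ m, 1 ≤ m → 0 < C m)
    (hest : ∀ m : ℕ, 1 ≤ m → ∀ f : Cn n → Fin n → ℂ, IsDbarClosedTestForm f D →
      ∀ ψ : Cn n → ℝ, IsSmoothStrictlyPSHOn ψ D →
        weightedIntegral D p m φ ψ (formNorm ψ f) ≠ ⊤ →
        ∃ u : Cn n → ℂ, SolvesDbarOn u f D ∧
          weightedIntegral D p m φ ψ (fun z => ‖u z‖) ≤
            ENNReal.ofReal (C m) * weightedIntegral D p m φ ψ (formNorm ψ f))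
    {w : Cn n} {s t R δ : ℝ} (hs : 0 < s) (ht : 0 < t) (hsD : closedBall w s ⊆ D)
    (hφ : ∀ y ∈ closedBall w s, |φ y - φ w| ≤ δ) :
    ∃ K : ℝ, 0 < K ∧ ∀ m : ℕ, 1 ≤ m → ∃ F : Cn n → ℂ, DifferentiableOn ℂ F D ∧ 1 / 2 ≤ ‖F w‖ ∧
      ∀ z, s + t ≤ ‖z - w‖ → ‖z - w‖ ≤ R → ball z t ⊆ D → (∀ y ∈ ball z t, φ y ≤ φ z + δ) →
        ‖F z‖ ^ p ≤ K * C m * Real.exp (m * (φ z - φ w + 2 * δ)) := by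
  obtain ⟨χ, hχs, hχc, hχD, hχ1, hχ0⟩ := exists_cutoff w hs
  set f : Cn n → Fin n → ℂ := fun z j => partialZBar j χ z with hf
  have hftest : IsDbarClosedTestForm f D :=
    isDbarClosedTestForm_partialZBar hχs hχc (hχD.trans hsD)
  have hfin : ∀ y, ‖y - w‖ < s / 2 → f y = 0 := fun y hy => by
    have h1 : χ =ᶠ[nhds y] fun _ => 1 :=
      Filter.eventuallyEq_of_mem (isOpen_ball.mem_nhds (mem_ball_iff_norm.2 hy)) hχ1
    funext j
    simp [hf, partialZBar, h1.fderiv_eq]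
  have hfout : ∀ y, s < ‖y - w‖ → f y = 0 := fun y hy => by
    have h1 : χ =ᶠ[nhds y] fun _ => 0 :=
      Filter.eventuallyEq_of_mem
        ((isOpen_lt continuous_const (continuous_id.sub continuous_const).norm).mem_nhds hy) hχ0
    funext j
    simp [hf, partialZBar, h1.fderiv_eq]
  obtain ⟨M, hM0, hM⟩ : ∃ M : ℝ, 0 < M ∧ ∀ y, Real.sqrt (∑ j, ‖f y j‖ ^ 2) ≤ M := by
    have hfc : Continuous f := hftest.smooth.continuous
    have hg : Continuous fun y => Real.sqrt (∑ j, ‖f y j‖ ^ 2) := by fun_prop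
    obtain ⟨M, hM⟩ := ((isCompact_closedBall w s).image hg).bddAbove
    refine ⟨max M 1, by positivity, fun y => ?_⟩
    by_cases hy : y ∈ closedBall w s
    · exact (hM (mem_image_of_mem _ hy)).trans (le_max_left _ _)
    · rw [hfout y (by simpa [dist_eq_norm] using hy)]
      simp
  have hp0 : 0 < p := by linarith
  set d := Module.finrank ℝ (Cn n) with hd
  have hdn : d = 2 * n := by rw [hd, finrank_real_of_complex, finrank_euclideanSpace_fin]
  set V := (volume (closedBall w s)).toReal with hV
  have hVt : volume (closedBall w s) = ENNReal.ofReal V :=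
    (ENNReal.ofReal_toReal measure_closedBall_lt_top.ne).symm
  set v := (volume (ball (0 : Cn n) 1)).toReal with hv
  have hvt : volume (ball (0 : Cn n) 1) = ENNReal.ofReal v :=
    (ENNReal.ofReal_toReal measure_ball_lt_top.ne).symm
  have hv0 : 0 < v :=
    ENNReal.toReal_pos (measure_ball_pos _ _ one_pos).ne' measure_ball_lt_top.ne
  have hV0 : 0 < V :=
    ENNReal.toReal_pos (measure_closedBall_pos _ _ hs).ne' measure_closedBall_lt_top.ne
  have hvol : ∀ (z : Cn n) (τ : ℝ), 0 < τ → volume (ball z τ) = ENNReal.ofReal (τ ^ d * v) := by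
    intro z τ hτ
    rw [Measure.addHaar_ball_of_pos _ _ hτ, hvt, ENNReal.ofReal_mul (by positivity)]
  set A := M ^ p * (((s / 2) ^ 2) ^ (n + 1))⁻¹ * V with hA
  have hA0 : 0 < A := by positivity
  -- A lower bound for `e^{-ψ}` on the ball of radius `R + t` about `w`, valid for all `ε ≤ 1`;
  -- hence `K` depends on neither `ε` nor `m`.
  set Q := Real.exp (-(R + t) ^ 2) * (((R + t) ^ 2 + 1) ^ (n + 1))⁻¹ with hQ
  have hQ0 : 0 < Q := by positivity
  refine ⟨A / (Q * (t ^ d * v)), by positivity, fun m hm => ?_⟩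
  have hCm := hC m hm
  -- Chosen so that `‖u w‖ ^ p ≤ B * ε ^ 2`. The factor `exp (m * (2 * δ))` collects one `δ` from
  -- the shell carrying `f` and one from the ball around `w`. As `B` depends on `m`, so does `ε`.
  set B := A * C m * Real.exp (m * (2 * δ)) * (Real.exp 1 * 2 ^ (n + 1)) / v with hB
  have hB0 : 0 < B := by positivity
  obtain ⟨ε, hε0, hε1, hεs, hεB⟩ : ∃ ε : ℝ, 0 < ε ∧ ε ≤ 1 ∧ ε ≤ s / 2 ∧
      B * ε ^ 2 ≤ (1 / 2) ^ p := by
    refine ⟨min (min 1 (s / 2)) ((1 / 2) ^ p / B), by positivity,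
      (min_le_left _ _).trans (min_le_left _ _), (min_le_left _ _).trans (min_le_right _ _), ?_⟩
    set ε := min (min 1 (s / 2)) ((1 / 2) ^ p / B) with hε
    have h0 : 0 < ε := by positivity
    have h1 : ε ≤ 1 := (min_le_left _ _).trans (min_le_left _ _)
    have h2 : ε ≤ (1 / 2) ^ p / B := min_le_right _ _
    rw [le_div_iff₀ hB0] at h2
    calc B * ε ^ 2 = ε * (ε * B) := by ring
      _ ≤ 1 * (ε * B) := by gcongr
      _ ≤ (1 / 2) ^ p := by rwa [one_mul]
  have hrhs := weightedIntegral_formNorm_logWeight_le (D := D) m hp hs hε0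
    (fun y hy => (show φ w - δ ≤ φ y by linarith [(abs_le.1 (hφ y hy)).1])) hM hfin hfout
  rw [hVt, ← ENNReal.ofReal_mul (by positivity)] at hrhs
  obtain ⟨u, ⟨huC, huf⟩, hule⟩ := hest m hm f hftest _ (isSmoothStrictlyPSHOn_logWeight w hε0 D)
    (hrhs.trans_lt ENNReal.ofReal_lt_top).ne
  replace hule := hule.trans (mul_le_mul_right hrhs _)
  rw [← ENNReal.ofReal_mul hCm.le] at hule
  have hu' : ∀ y ∈ D, DifferentiableAt ℝ u y := fun y hy =>
    (huC.differentiableOn (by simp)).differentiableAt (hDo.mem_nhds hy)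
  have hχ' : ∀ y, DifferentiableAt ℝ χ y := fun y => hχs.differentiable (by simp) y
  have hF : DifferentiableOn ℂ (fun y => χ y - u y) D := by
    intro y hy
    refine (differentiableAt_complex_of_partialZBar_eq_zero ((hχ' y).sub (hu' y hy))
      fun j => ?_).differentiableWithinAt
    have h1 := huf y hy j
    rw [partialZBar, fderiv_sub (hχ' y) (hu' y hy)]
    simp only [hf, partialZBar, _root_.sub_apply] at h1 ⊢
    linear_combination -h1
  have hmain : ∀ (z : Cn n) (τ κ : ℝ), 0 < τ → 0 ≤ κ → ball z τ ⊆ D →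
      DifferentiableOn ℂ u (ball z τ) →
      (∀ y ∈ ball z τ, κ ≤ Real.exp (-(m * φ y) - logWeight w ε y)) →
      ‖u z‖ ^ p * (τ ^ d * v) * κ ≤ C m * (A * Real.exp (-(m * (φ w - δ)))) := by
    intro z τ κ hτ hκ hzD hud hκw
    have h1 := (enorm_rpow_mul_volume_ball_mul_le_weightedIntegral m hp hzD hud hκw).trans hule
    rw [hvol z τ hτ, ← ofReal_norm, ENNReal.ofReal_rpow_of_nonneg (norm_nonneg _) hp0.le,
      ← ENNReal.ofReal_mul (by positivity), ← ENNReal.ofReal_mul (by positivity),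
      ENNReal.ofReal_le_ofReal_iff (by positivity)] at h1
    refine h1.trans (le_of_eq ?_)
    rw [hA]
    ring
  refine ⟨fun y => χ y - u y, hF, ?_, fun z hz1 hz2 hzD hzφ => ?_⟩
  · have hbs : ball w ε ⊆ ball w (s / 2) := ball_subset_ball hεs
    have hbD : ball w ε ⊆ D := fun y hy =>
      hsD (ball_subset_closedBall (ball_subset_ball (by linarith) (hbs hy)))
    have hud : DifferentiableOn ℂ u (ball w ε) := by
      refine ((hF.mono hbD).const_sub 1).congr fun y hy => ?_
      rw [hχ1 y (hbs hy)]
      ring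
    have h1 := hmain w ε (Real.exp (-(m * (φ w + δ))) *
      (Real.exp (-1) * ((2 * ε ^ 2) ^ (n + 1))⁻¹)) hε0 (by positivity) hbD hud ?_
    · have h2 : ‖u w‖ ^ p ≤ B * ε ^ 2 := by
        have h3 : Real.exp (-(m * (φ w - δ))) =
            Real.exp (-(m * (φ w + δ))) * Real.exp (m * (2 * δ)) := by
          rw [← Real.exp_add]
          ring_nf
        -- The volume `ε ^ (2 * n)` against the weight `ε ^ (-2 * (n + 1))` leaves `ε ^ (-2)` on the
        -- left: the reason for the coefficient `n + 1` in `logWeight`.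
        rw [h3, hdn, Real.exp_neg 1, mul_pow, ← pow_mul] at h1
        have h4 : ‖u w‖ ^ p * (ε ^ (2 * n) * v) * (Real.exp (-(m * (φ w + δ))) *
            ((Real.exp 1)⁻¹ * (2 ^ (n + 1) * ε ^ (2 * (n + 1)))⁻¹)) =
            ‖u w‖ ^ p * (Real.exp (-(m * (φ w + δ))) * v
              / (Real.exp 1 * 2 ^ (n + 1) * ε ^ 2)) := by
          field_simp
          ring
        rw [h4, ← le_div_iff₀ (by positivity)] at h1
        refine h1.trans (le_of_eq ?_)
        rw [hB]
        field_simp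
      have h3 : ‖u w‖ ≤ 1 / 2 :=
        (Real.rpow_le_rpow_iff (norm_nonneg _) (by norm_num) hp0).1 (h2.trans hεB)
      have h4 := norm_sub_norm_le (χ w) (u w)
      rw [hχ1 w (mem_ball_self (by positivity)), norm_one] at h4
      change 1 / 2 ≤ ‖χ w - u w‖
      rw [hχ1 w (mem_ball_self (by positivity))]
      linarith
    · intro y hy
      have hys : y ∈ closedBall w s :=
        ball_subset_closedBall (ball_subset_ball (by linarith) (hbs hy))
      have hφy : φ y ≤ φ w + δ := by linarith [(abs_le.1 (hφ y hys)).2]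
      rw [mem_ball_iff_norm] at hy
      have hq : ‖y - w‖ ^ 2 ≤ ε ^ 2 := by gcongr
      have hε2 : ε ^ 2 ≤ 1 := pow_le_one₀ hε0.le hε1
      rw [sub_eq_add_neg, Real.exp_add, exp_neg_logWeight w y hε0]
      gcongr
      · linarith
      · linarith
  · have hout : ∀ y ∈ ball z t, χ y = 0 := fun y hy => hχ0 y (by
      rw [mem_ball_iff_norm'] at hy
      have h1 := norm_add_le (z - y) (y - w)
      rw [sub_add_sub_cancel] at h1
      linarith)
    have hud : DifferentiableOn ℂ u (ball z t) := by
      refine (hF.mono hzD).neg.congr fun y hy => ?_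
      simp [hout y hy]
    have h1 := hmain z t (Real.exp (-(m * (φ z + δ))) * Q) ht (by positivity) hzD hud ?_
    · change ‖χ z - u z‖ ^ p ≤ _
      rw [hout z (mem_ball_self ht), zero_sub, norm_neg]
      have h3 : Real.exp (-(m * (φ w - δ))) =
          Real.exp (-(m * (φ z + δ))) * Real.exp (m * (φ z - φ w + 2 * δ)) := by
        rw [← Real.exp_add]
        ring_nf
      rw [h3] at h1
      have h4 : ‖u z‖ ^ p * (t ^ d * v) * (Real.exp (-(m * (φ z + δ))) * Q) =
          ‖u z‖ ^ p * (Real.exp (-(m * (φ z + δ))) * Q * (t ^ d * v)) := by ring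
      rw [h4, ← le_div_iff₀ (by positivity)] at h1
      refine h1.trans (le_of_eq ?_)
      field_simp
    · intro y hy
      have hφy := hzφ y hy
      have hq : ‖y - w‖ ≤ R + t := by
        rw [mem_ball_iff_norm] at hy
        have h1 := norm_add_le (y - z) (z - w)
        rw [sub_add_sub_cancel] at h1
        linarith
      have hq2 : ‖y - w‖ ^ 2 ≤ (R + t) ^ 2 := by gcongr
      have hε2 : ε ^ 2 ≤ 1 := pow_le_one₀ hε0.le hε1
      rw [sub_eq_add_neg, Real.exp_add, exp_neg_logWeight w y hε0, hQ]
      gcongr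

/-! ### The limit `m → ∞` and the sub-mean value inequality. -/

theorem le_circleAverage_of_coarseEstimate {D : Set (Cn n)} (hDo : IsOpen D) {φ : Cn n → ℝ}
    (hφ : ContinuousOn φ D) {p : ℝ} (hp : 1 < p) (h : MultipleCoarseEstimateProperty p D φ)
    {a b : Cn n} (hb : b ≠ 0) {c : ℂ} {r : ℝ} (hr : 0 < r)
    (hball : closedBall c r ⊆ {ζ : ℂ | a + ζ • b ∈ D}) :
    φ (a + c • b) ≤ Real.circleAverage (fun ζ : ℂ => φ (a + ζ • b)) c r := by
  obtain ⟨C, hC, hlim, hest⟩ := h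
  have hp0 : 0 < p := by linarith
  set ℓ : ℂ → Cn n := fun ζ => a + ζ • b with hℓ
  have hℓc : Continuous ℓ := by fun_prop
  set w := ℓ c with hw
  have hwD : w ∈ D := hball (mem_closedBall_self hr.le)
  have hnorm : ∀ ζ ∈ sphere c r, ‖ℓ ζ - w‖ = r * ‖b‖ := by
    intro ζ hζ
    rw [hw, hℓ]
    simp only [add_sub_add_left_eq_sub, ← sub_smul, norm_smul]
    rw [mem_sphere_iff_norm.1 hζ]
  have hint : CircleIntegrable (fun ζ => φ (ℓ ζ)) c r :=
    (hφ.comp hℓc.continuousOn fun ζ hζ => hball (sphere_subset_closedBall hζ)).circleIntegrable hr.le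
  refine le_of_forall_pos_le_add fun η hη => ?_
  -- The growth bound loses `2 * δ`, which is exactly `η`.
  set δ := η / 2 with hδ
  have hδ0 : 0 < δ := by positivity
  have hrb : 0 < r * ‖b‖ := mul_pos hr (norm_pos_iff.2 hb)
  have hloc : ∀ z ∈ D, ∃ s, 0 < s ∧ ∀ y ∈ closedBall z s, y ∈ D ∧ |φ y - φ z| ≤ δ / 2 := by
    intro z hz
    have h1 : ∀ᶠ y in nhds z, y ∈ D ∧ |φ y - φ z| ≤ δ / 2 := by
      refine (hDo.eventually_mem hz).and ?_
      filter_upwards [(hφ.continuousAt (hDo.mem_nhds hz)).eventually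
        (closedBall_mem_nhds (φ z) (half_pos hδ0))] with y hy
      simpa [Real.dist_eq] using hy
    obtain ⟨s, hs, h2⟩ := nhds_basis_closedBall.eventually_iff.1 h1
    exact ⟨s, hs, fun y hy => h2 hy⟩
  obtain ⟨s₀, hs₀, hs₀D⟩ := hloc w hwD
  set s := min s₀ (r * ‖b‖ / 2) with hs
  have hspos : 0 < s := by positivity
  have hsD : ∀ y ∈ closedBall w s, y ∈ D ∧ |φ y - φ w| ≤ δ := fun y hy => by
    obtain ⟨h1, h2⟩ := hs₀D y (closedBall_subset_closedBall (min_le_left _ _) hy)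
    exact ⟨h1, h2.trans (by linarith)⟩
  have hSc : IsCompact (ℓ '' sphere c r) := (isCompact_sphere c r).image hℓc
  obtain ⟨t₀, ht₀, ht₀D⟩ : ∃ t, 0 < t ∧ ∀ z ∈ ℓ '' sphere c r, ∀ y ∈ ball z t,
      y ∈ D ∧ |φ y - φ z| ≤ δ := by
    have hcover : ∀ z ∈ ℓ '' sphere c r, ∃ s, 0 < s ∧
        ∀ y ∈ closedBall z s, y ∈ D ∧ |φ y - φ z| ≤ δ / 2 := by
      rintro _ ⟨ζ, hζ, rfl⟩
      exact hloc _ (hball (sphere_subset_closedBall hζ))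
    choose! σ hσ hσD using hcover
    -- A radius uniform over the compact circle. Both `y` and `z` are compared with the centre `x`
    -- of a covering ball, hence the `δ / 2` in `hloc`.
    obtain ⟨t, ht, hleb⟩ := lebesgue_number_lemma_of_metric (c := fun z : ℓ '' sphere c r =>
      ball (z : Cn n) (σ z)) hSc (fun _ => isOpen_ball)
      fun z hz => mem_iUnion.2 ⟨⟨z, hz⟩, mem_ball_self (hσ z hz)⟩
    refine ⟨t, ht, fun z hz y hy => ?_⟩
    obtain ⟨⟨x, hx⟩, hxt⟩ := hleb z hz
    obtain ⟨h1, h2⟩ := hσD x hx y (ball_subset_closedBall (hxt hy))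
    obtain ⟨-, h3⟩ := hσD x hx z (ball_subset_closedBall (hxt (mem_ball_self ht)))
    refine ⟨h1, ?_⟩
    rw [abs_le] at h2 h3 ⊢
    constructor <;> linarith [h2.1, h2.2, h3.1, h3.2]
  -- Both `s` and `t` are at most half of `r * ‖b‖`, so the circle, all of whose points lie at
  -- distance `r * ‖b‖` from `w`, satisfies `s + t ≤ ‖z - w‖`.
  set t := min t₀ (r * ‖b‖ / 2) with ht
  have htpos : 0 < t := by positivity
  obtain ⟨K, hK, hKF⟩ := exists_holomorphic_of_coarseEstimate hDo hp hC hest (R := r * ‖b‖) hspos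
    htpos (fun y hy => (hsD y hy).1) (fun y hy => (hsD y hy).2)
  have hineq : ∀ m : ℕ, 1 ≤ m → p * Real.log (1 / 2) ≤ Real.log K + Real.log (C m)
      + m * (Real.circleAverage (fun ζ => φ (ℓ ζ)) c r - φ w + 2 * δ) := by
    intro m hm
    obtain ⟨F, hF, hFw, hFz⟩ := hKF m hm
    have hCm := hC m hm
    have hUo : IsOpen {ζ : ℂ | ℓ ζ ∈ D} := hDo.preimage hℓc
    have han : AnalyticOnNhd ℂ (fun ζ => F (ℓ ζ)) (closedBall c r) := by
      refine AnalyticOnNhd.mono ?_ hball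
      refine DifferentiableOn.analyticOnNhd ?_ hUo
      exact hF.comp (f := ℓ) (by fun_prop) fun ζ hζ => hζ
    have hne : F (ℓ c) ≠ 0 := by
      rw [← norm_pos_iff]
      change 0 < ‖F w‖
      linarith
    have hsint : CircleIntegrable (fun ζ => ((m : ℝ) / p) • φ (ℓ ζ)) c r := hint.const_smul
    have hGint : CircleIntegrable (fun ζ => ((m : ℝ) / p) • φ (ℓ ζ)
        + (Real.log K + Real.log (C m) + m * (-φ w + 2 * δ)) / p) c r :=
      hsint.add (circleIntegrable_const _ _ _)
    have h1 := log_norm_le_circleAverage_of_norm_le_exp hr han hne hGint ?_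
    · rw [Real.circleAverage_fun_add hsint (circleIntegrable_const _ _ _),
        Real.circleAverage_const, Real.circleAverage_fun_smul] at h1
      have h2 : Real.log (1 / 2) ≤ Real.log ‖F (ℓ c)‖ := Real.log_le_log (by norm_num) hFw
      have h3 := mul_le_mul_of_nonneg_left (h2.trans h1) hp0.le
      refine h3.trans (le_of_eq ?_)
      simp only [smul_eq_mul]
      field_simp
      ring
    · intro ζ hζ hFζ
      have hmem : ℓ ζ ∈ ℓ '' sphere c r := mem_image_of_mem _ hζ
      have hst : s + t ≤ r * ‖b‖ := by
        linarith [min_le_right s₀ (r * ‖b‖ / 2), min_le_right t₀ (r * ‖b‖ / 2)]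
      have hsub : ball (ℓ ζ) t ⊆ ball (ℓ ζ) t₀ := ball_subset_ball (min_le_left _ _)
      have h2 := hFz (ℓ ζ) (by rw [hnorm ζ hζ]; exact hst) (hnorm ζ hζ).le
        (fun y hy => (ht₀D _ hmem y (hsub hy)).1)
        (fun y hy => by linarith [(abs_le.1 (ht₀D _ hmem y (hsub hy)).2).2])
      have h3 : 0 < ‖F (ℓ ζ)‖ := norm_pos_iff.2 hFζ
      have h4 := Real.log_le_log (Real.rpow_pos_of_pos h3 p) h2
      rw [Real.log_rpow h3, Real.log_mul (by positivity) (Real.exp_ne_zero _),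
        Real.log_mul hK.ne' hCm.ne', Real.log_exp, ← le_div_iff₀' hp0] at h4
      refine h4.trans (le_of_eq ?_)
      simp only [smul_eq_mul]
      field_simp
      ring
  have hlim2 : Filter.Tendsto (fun m : ℕ => (Real.log K - p * Real.log (1 / 2)) / m
      + Real.log (C m) / m) Filter.atTop (nhds (0 + 0)) :=
    (tendsto_const_div_atTop_nhds_zero_nat _).add hlim
  have hge : φ w - Real.circleAverage (fun ζ => φ (ℓ ζ)) c r - 2 * δ ≤ 0 + 0 := by
    refine ge_of_tendsto hlim2 ?_
    filter_upwards [Filter.eventually_ge_atTop 1] with m hm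
    have hm0 : (0 : ℝ) < m := by exact_mod_cast hm
    rw [← add_div, le_div_iff₀ hm0]
    linarith [hineq m hm]
  change φ w ≤ Real.circleAverage (fun ζ => φ (ℓ ζ)) c r + η
  linarith

end CoarseEstimate

theorem theorem1p3 (n : ℕ) (D : Set (CoarseEstimate.Cn n)) (hDo : IsOpen D) (hDc : IsConnected D)
    (φ : CoarseEstimate.Cn n → ℝ) (hφ : ContinuousOn φ D) (p : ℝ) (hp : 1 < p)
    (h : CoarseEstimate.MultipleCoarseEstimateProperty p D φ) :
    CoarseEstimate.IsPlurisubharmonicOn φ D := by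
  refine ⟨hφ.upperSemicontinuousOn, fun a b => ?_⟩
  have hcont : ContinuousOn (fun ζ : ℂ => φ (a + ζ • b)) {ζ : ℂ | a + ζ • b ∈ D} :=
    hφ.comp (f := fun ζ : ℂ => a + ζ • b) (by fun_prop) fun ζ hζ => hζ
  refine ⟨hcont.upperSemicontinuousOn, fun c r hr hball =>
    ⟨(hcont.mono (sphere_subset_closedBall.trans hball)).circleIntegrable hr.le, ?_⟩⟩
  -- For `b = 0` the circle collapses to its centre, where no growth bound is available, but the
  -- restriction is constant.
  rcases eq_or_ne b 0 with rfl | hb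
  · simp [Real.circleAverage_const]
  · exact CoarseEstimate.le_circleAverage_of_coarseEstimate hDo hφ hp h hb hr hball
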